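/- Let $\mathcal D$ be a square torus of side $a>0$ with its flat distance and Lebesgue measure, let $K$ be a number of orthogonal bands, and let $\mathcal P(K)$ be the set of non-empty subsets of $\{1,\dots,K\}$ (the classes). Fix $\lambda>0$, $r\ge 0$, $\mathcal N_0>0$, a probability vector $(p_C)_{C\in\mathcal P(K)}$, mean file sizes $L_C>0$, and a non-negative non-increasing path-loss function $\ell$ on $[0,\infty)$ with $\ell(0)=1$. A user is a triple $(x,y,C)$ made of a receiver location $x\in\mathcal D$, a transmitter location $y\in\mathcal D$ and a class $C\in\mathcal P(K)$. Consider the spatial birth-and-death Markov jump process $(\Phi_t)_{t\ge0}$ on finite configurations of users with the following dynamics: - transmitters arrive according to a space-time Poisson process of intensity $\lambda\,\mathrm dy\,\mathrm dt$ on $\mathcal D\times[0,\infty)$; independently for each arrival, the receiver is placed at $x=y+r(\cos\theta,\sin\theta)$ with $\theta$ uniform on the circle, and the class is $C$ with probability $p_C$; - each user $u=(x,y,C)$ of the current configuration $\Phi$ leaves at rate $$\frac{1}{L_C}\,R(u,\Phi),\qquad R(u,\Phi)=\frac{|C|\,\ell(r)}{\mathcal N_0+\sum_{(x',y',C')\in\Phi\setminus\{u\}}|C\cap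 C'|\,\ell(\|x-y'\|)}$$ (that is, file sizes in class $C$ are exponential with mean $L_C$ and are served at rate $R$). Suppose that the network is symmetric: $p_C=p_D$ and $L_C=L_D$ whenever $|C|=|D|$. Let $\Phi_0$ be distributed according to a stationary law of this process, that is, an invariant probability measure, and for $C\in\mathcal P(K)$ let $$\mu_C=\frac{1}{|\mathcal D|}\,\mathbb E\big[\Phi_{C,0}(\mathcal D)\big]\in[0,\infty]$$ be the user density of class $C$, where $\Phi_{C,0}(\mathcal D)$ is the number of users of class $C$ in $\Phi_0$. Then $$\forall\, C,D\in\mathcal P(K),\qquad |C|=|D|\ \Longrightarrow\ \mu_C=\mu_D .$$ -/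

import Mathlib

open MeasureTheory Set
open scoped ENNReal

noncomputable section

namespace WirelessSBD

/-- The set `𝒫(K)` of classes: non-empty sets of bands. -/
abbrev BandClass (K : ℕ) : Type := {C : Finset (Fin K) // C.Nonempty}

/-- The finite set of classes carries the discrete σ-algebra. -/
instance (K : ℕ) : MeasurableSpace (BandClass K) := ⊤

/-- The square torus of side `a`. -/
abbrev Torus (a : ℝ) : Type := AddCircle a × AddCircle a

/-- The Euclidean (flat) distance on the square torus. -/
def torusDist {a : ℝ} (x y : Torus a) : ℝ :=
  Real.sqrt (‖x.1 - y.1‖ ^ 2 + ‖x.2 - y.2‖ ^ 2)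

/-- A user: (location of the receiver, location of the transmitter, class). -/
abbrev User (a : ℝ) (K : ℕ) : Type := Torus a × Torus a × BandClass K

namespace User

variable {a : ℝ} {K : ℕ}

/-- Location of the receiver. -/
def receiver (u : User a K) : Torus a := u.1

/-- Location of the transmitter. -/
def transmitter (u : User a K) : Torus a := u.2.1

/-- Class of the user. -/
def bands (u : User a K) : BandClass K := u.2.2

end User

/-- The σ-algebra on finite point configurations (finite counting measures) on `α`: a set of
configurations is measurable iff, for every `n`, the `n`-tuples of points whose configuration lies
in it form a measurable set of `Fin n → α`. -/
instance configMeasurableSpace (α : Type*) [MeasurableSpace α] : MeasurableSpace (Multiset α) :=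
  MeasurableSpace.map (fun s : Σ n : ℕ, (Fin n → α) => (List.ofFn s.2 : Multiset α)) inferInstance

/-- A configuration of the network: a finite multiset of users. -/
abbrev Config (a : ℝ) (K : ℕ) : Type := Multiset (User a K)

/-- Adding a user to a given configuration is a measurable operation. -/
theorem measurable_cons {α : Type*} [MeasurableSpace α] (Φ : Multiset α) :
    Measurable (fun u : α => u ::ₘ Φ) := by
  obtain ⟨l, rfl⟩ := Quotient.exists_rep Φ
  have h1 : Measurable (fun s : Σ n : ℕ, (Fin n → α) => (List.ofFn s.2 : Multiset α)) :=
    fun _ hs => hs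
  have h2 : Measurable (fun u : α =>
      (⟨l.length + 1, Fin.cons u l.get⟩ : Σ n : ℕ, (Fin n → α))) := by
    have h3 : Measurable (fun u : α => (Fin.cons u l.get : Fin (l.length + 1) → α)) := by
      refine measurable_pi_lambda _ fun i => ?_
      refine Fin.cases ?_ (fun j => ?_) i
      · exact measurable_id
      · simp
    have h5 : Measurable (fun f : Fin (l.length + 1) → α =>
        (⟨l.length + 1, f⟩ : Σ n : ℕ, (Fin n → α))) :=
      fun s hs => MeasurableSpace.measurableSet_iInf.1 hs (l.length + 1)
    exact h5.comp h3
  have h4 : (fun u : α => u ::ₘ (Quotient.mk _ l : Multiset α)) =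
      (fun s : Σ n : ℕ, (Fin n → α) => (List.ofFn s.2 : Multiset α)) ∘
        (fun u : α => (⟨l.length + 1, Fin.cons u l.get⟩ : Σ n : ℕ, (Fin n → α))) := by
    funext u
    simp only [Function.comp, List.ofFn_cons, List.ofFn_get]
    rfl
  rw [h4]
  exact h1.comp h2

/-- The parameters of a network with `K` bands. -/
structure Network (K : ℕ) where
  /-- space-time intensity of the Poisson rain of arrivals -/
  lam : ℝ
  /-- distance between the receiver and the transmitter of a user -/
  r : ℝ
  /-- thermal noise power -/
  noise : ℝ
  /-- path-loss function; only its values at non-negative distances matter -/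
  pathLoss : ℝ → ℝ
  /-- probability that an arriving user has a given class -/
  p : BandClass K → ℝ
  /-- mean file size of the users of a given class -/
  L : BandClass K → ℝ
  lam_pos : 0 < lam
  r_nonneg : 0 ≤ r
  noise_pos : 0 < noise
  pathLoss_nonneg : ∀ d, 0 ≤ d → 0 ≤ pathLoss d
  pathLoss_antitone : AntitoneOn pathLoss (Ici 0)
  pathLoss_zero : pathLoss 0 = 1
  p_nonneg : ∀ C, 0 ≤ p C
  p_sum : ∑ C, p C = 1
  L_pos : ∀ C, 0 < L C

namespace Network

variable {K : ℕ} (N : Network K) {a : ℝ}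

/-- The network is symmetric: users whose classes have the same cardinality have the same arrival
probability and the same file size distribution. -/
def IsSymmetric : Prop :=
  ∀ C D : BandClass K, C.1.card = D.1.card → N.p C = N.p D ∧ N.L C = N.L D

/-- Interference at the receiver of `u` created by the transmitters of the users in `Ψ`. -/
def interference (u : User a K) (Ψ : Config a K) : ℝ :=
  (Ψ.map fun z => ((u.bands.1 ∩ z.bands.1).card : ℝ) *
    N.pathLoss (torusDist u.receiver z.transmitter)).sum

open Classical in
/-- Rate of transmission of a user `u` of the configuration `Φ`; the user's own transmitter is
removed from the interference. -/
def rate (u : User a K) (Φ : Config a K) : ℝ :=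
  (u.bands.1.card : ℝ) * N.pathLoss N.r / (N.noise + N.interference u (Φ.erase u))

/-- Instantaneous departure rate of a user `u` of the configuration `Φ`: the file sizes in class
`C` are exponential with mean `L C`. -/
def deathRate (u : User a K) (Φ : Config a K) : ℝ :=
  N.rate u Φ / N.L u.bands

/-- The user of class `C` with transmitter at `y` and receiver at distance `N.r` from `y` in the
direction `θ`. -/
def dipole (C : BandClass K) (y : Torus a) (θ : ℝ) : User a K :=
  (y + (((N.r * Real.cos θ : ℝ) : AddCircle a), ((N.r * Real.sin θ : ℝ) : AddCircle a)), y, C)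

/-- The dipole depends measurably on the location of the transmitter and the direction. -/
theorem measurable_dipole (C : BandClass K) :
    Measurable (fun q : Torus a × ℝ => N.dipole C q.1 q.2) := by
  have hc : Measurable (fun x : ℝ => (x : AddCircle a)) :=
    (AddCircle.continuous_mk' a).measurable
  have h1 : Measurable (fun q : Torus a × ℝ => ((N.r * Real.cos q.2 : ℝ) : AddCircle a)) :=
    hc.comp (by fun_prop)
  have h2 : Measurable (fun q : Torus a × ℝ => ((N.r * Real.sin q.2 : ℝ) : AddCircle a)) :=
    hc.comp (by fun_prop)
  exact (measurable_fst.add (h1.prodMk h2)).prodMk (measurable_fst.prodMk measurable_const)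

variable [Fact (0 < a)]

/-- Arrival rates of users: the transmitter has intensity `λ dy`, the direction of the receiver is
uniform on the circle, the class has law `p`, all independent. -/
def arrivals : Measure (User a K) :=
  ∑ C : BandClass K, ENNReal.ofReal (N.lam * N.p C) •
    ((volume : Measure (Torus a)).prod
      ((ENNReal.ofReal (2 * Real.pi))⁻¹ • volume.restrict (Ioc 0 (2 * Real.pi)))).map
        (fun q : Torus a × ℝ => N.dipole C q.1 q.2)

open Classical in
/-- Jump rates of the spatial birth-and-death process: arrivals, and departures of the present
users `u` at rate `deathRate u Φ`. -/
def jumpRate (Φ : Config a K) : Measure (Config a K) :=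
  (N.arrivals (a := a)).map (fun u => u ::ₘ Φ) +
    (Φ.map fun u => ENNReal.ofReal (N.deathRate u Φ) • Measure.dirac (Φ.erase u)).sum

/-- `transitionAux n t Φ A` is the probability that the jump process with rates `jumpRate`,
started from `Φ`, makes fewer than `n` jumps up to time `t` and lies in `A` at time `t`
(decomposition at the first jump, which happens at rate `jumpRate Φ univ`). -/
def transitionAux : ℕ → ℝ → Config a K → Set (Config a K) → ℝ≥0∞
  | 0, _, _, _ => 0
  | n + 1, t, Φ, A =>
      ENNReal.ofReal (Real.exp (-((N.jumpRate Φ).real univ * t))) * A.indicator 1 Φ +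
        ∫⁻ s in Ioc 0 t, ENNReal.ofReal (Real.exp (-((N.jumpRate Φ).real univ * s))) *
          ∫⁻ Ψ, transitionAux n (t - s) Ψ A ∂(N.jumpRate Φ)

/-- Transition function `P_t(Φ, A)` of the Markov jump process with rates `jumpRate`. -/
def transition (t : ℝ) (Φ : Config a K) (A : Set (Config a K)) : ℝ≥0∞ :=
  ⨆ n : ℕ, N.transitionAux n t Φ A

/-- `π` is the law of the network in a stationary regime: a probability measure on configurations
that is invariant under the Markov jump process. -/
def IsStationary (π : Measure (Config a K)) : Prop :=
  IsProbabilityMeasure π ∧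
    ∀ t : ℝ, 0 ≤ t → ∀ A : Set (Config a K), MeasurableSet A →
      ∫⁻ Φ, N.transition t Φ A ∂π = π A

end Network

/-- User density of class `C` under the law `π`: the expected number of users of class `C` divided
by the area of the torus. -/
def userDensity {K : ℕ} {a : ℝ} [Fact (0 < a)] (π : Measure (Config a K)) (C : BandClass K) :
    ℝ≥0∞ :=
  (∫⁻ Φ : Config a K, (Multiset.card (Φ.filter fun u => u.bands = C) : ℝ≥0∞) ∂π) /
    volume (univ : Set (Torus a))

end WirelessSBD

end

/-!
A permutation of the bands that preserves the arrival probabilities and the mean file sizes maps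
the jump rates to themselves, hence also the transition function. It therefore sends a measure
invariant under `P_t` to another one of the same mass, and the point is that there is only one.

Suppose first that `ℓ(r) > 0`. A network of `n` users empties within time `t` with a probability
bounded below in terms of `n`: each departure has a rate bounded below and the total jump rate is
bounded above. Two invariant measures `μ` and `ν` of equal mass then coincide: `μ - ν` and `ν - μ`
live on complementary sets, and invariance tested on the one of these that contains the empty
configuration forbids the mass lying on the other from ever reaching it.
If `ℓ(r) = 0`, nobody ever leaves, and the only finite invariant measure is zero.
-/

namespace WirelessSBD

section Measures

variable {X Y : Type*} [MeasurableSpace X] [MeasurableSpace Y]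

theorem multiset_sum_measure_apply (m : Multiset (Measure X)) (s : Set X) :
    m.sum s = (m.map fun μ => μ s).sum := by
  induction m using Multiset.induction_on with
  | empty => simp
  | cons μ m ih => simp [ih]

theorem map_multiset_sum_measure (m : Multiset (Measure X)) {f : X → Y} (hf : Measurable f) :
    m.sum.map f = (m.map fun μ => μ.map f).sum := by
  simpa only [Measure.mapₗ_apply_of_measurable hf] using map_multiset_sum (Measure.mapₗ f) m

theorem measure_add_sub_eq_add_sub (μ ν : Measure X) [IsFiniteMeasure μ] [IsFiniteMeasure ν] :
    μ + (ν - μ) = ν + (μ - ν) := by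
  rw [← Measure.toSignedMeasure_eq_toSignedMeasure_iff, Measure.toSignedMeasure_add,
    Measure.toSignedMeasure_add, add_comm ν.toSignedMeasure]
  exact sub_eq_sub_iff_add_eq_add.1 Measure.sub_toSignedMeasure_eq_toSignedMeasure_sub

theorem measure_eq_zero_of_lintegral_eq_zero {μ : Measure X} {f : X → ℝ≥0∞} (hf : Measurable f)
    (hf0 : ∀ x, f x ≠ 0) (h : ∫⁻ x, f x ∂μ = 0) : μ = 0 := by
  rw [lintegral_eq_zero_iff hf] at h
  exact ae_eq_bot.1 (Filter.eventually_false_iff_eq_bot.1 (h.mono hf0))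

theorem lintegral_exp_neg_mul {q t : ℝ} (hq : 0 ≤ q) (ht : 0 ≤ t) :
    ∫⁻ s in Ioc 0 t, ENNReal.ofReal (Real.exp (-(q * s))) * ENNReal.ofReal q =
      ENNReal.ofReal (1 - Real.exp (-(q * t))) := by
  have hcont : Continuous fun s : ℝ => Real.exp (-(q * s)) * q := by fun_prop
  have hderiv (s : ℝ) :
      HasDerivAt (fun s => -Real.exp (-(q * s))) (Real.exp (-(q * s)) * q) s := by
    simpa using ((hasDerivAt_id s).const_mul q).fun_neg.exp.fun_neg
  have hint : ∫ s in (0 : ℝ)..t, Real.exp (-(q * s)) * q = 1 - Real.exp (-(q * t)) := by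
    rw [intervalIntegral.integral_eq_sub_of_hasDerivAt (fun s _ => hderiv s)
      (hcont.intervalIntegrable _ _)]
    simp [neg_add_eq_sub]
  rw [← hint, intervalIntegral.integral_of_le ht, ofReal_integral_eq_lintegral_ofReal
    hcont.integrableOn_Ioc (Filter.Eventually.of_forall fun s => by positivity)]
  exact lintegral_congr fun s => (ENNReal.ofReal_mul (Real.exp_pos _).le).symm

end Measures

section Invariance

variable {X : Type*} [MeasurableSpace X] {κ : X → Set X → ℝ≥0∞} {μ ν : Measure X}

/-- Invariance of the measure `μ` under the transition function `κ`. Neither the measurability of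
`κ` in its first argument nor its additivity in the second one is part of the notion, so that it
applies to `Network.transition` as it stands. -/
def IsInvariant (κ : X → Set X → ℝ≥0∞) (μ : Measure X) : Prop :=
  ∀ s, MeasurableSet s → ∫⁻ x, κ x s ∂μ = μ s

theorem IsInvariant.map_equiv {e : X ≃ᵐ X} (hκ : ∀ x s, κ (e x) s = κ x (e ⁻¹' s))
    (hμ : IsInvariant κ μ) : IsInvariant κ (μ.map e) := fun s hs => by
  rw [lintegral_map_equiv, e.map_apply, ← hμ _ (e.measurable hs)]
  exact lintegral_congr fun x => hκ x s

variable [IsFiniteMeasure μ] [IsFiniteMeasure ν]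

theorem lintegral_measure_sub_eq_zero {s : Set X} {f : X → ℝ≥0∞} (hf : ∀ x, f x ≤ 1)
    (hs : (ν - μ) s = 0) (hs' : (μ - ν) sᶜ = 0) (hμ : ∫⁻ x, f x ∂μ = μ s)
    (hν : ∫⁻ x, f x ∂ν = ν s) : ∫⁻ x, f x ∂(ν - μ) = 0 := by
  have hmass : μ s = ν s + (μ - ν) s := by
    simpa [hs] using congrArg (fun ρ : Measure X => ρ s) (measure_add_sub_eq_add_sub μ ν)
  have hint : μ s + ∫⁻ x, f x ∂(ν - μ) = ν s + ∫⁻ x, f x ∂(μ - ν) := by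
    simpa only [lintegral_add_measure, hμ, hν] using
      congrArg (fun ρ : Measure X => ∫⁻ x, f x ∂ρ) (measure_add_sub_eq_add_sub μ ν)
  have hle : ∫⁻ x, f x ∂(μ - ν) ≤ (μ - ν) s := calc
    ∫⁻ x, f x ∂(μ - ν) ≤ (μ - ν) univ := by simpa using lintegral_mono hf
    _ ≤ (μ - ν) s + (μ - ν) sᶜ := by simpa using measure_union_le s sᶜ
    _ = (μ - ν) s := by rw [hs', add_zero]
  refine nonpos_iff_eq_zero.1 (ENNReal.le_of_add_le_add_left (measure_ne_top μ s) ?_)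
  calc μ s + ∫⁻ x, f x ∂(ν - μ) = ν s + ∫⁻ x, f x ∂(μ - ν) := hint
    _ ≤ ν s + (μ - ν) s := by gcongr
    _ = μ s + 0 := by rw [hmass, add_zero]

theorem measure_eq_of_sub_eq_zero (h : ν - μ = 0) (huniv : μ univ = ν univ) : μ = ν := by
  have hadd : μ = ν + (μ - ν) := by simpa [h] using measure_add_sub_eq_add_sub μ ν
  have hle : ν ≤ μ := (Measure.le_add_right le_rfl).trans_eq hadd.symm
  exact (Measure.eq_of_le_of_measure_univ_eq hle huniv.symm).symm

theorem IsInvariant.eq_of_minorization (hκ : ∀ x s, κ x s ≤ 1) (x₀ : X) {g : X → ℝ≥0∞}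
    (hg : Measurable g) (hg0 : ∀ x, g x ≠ 0) (hgκ : ∀ x s, x₀ ∈ s → g x ≤ κ x s)
    (hμ : IsInvariant κ μ) (hν : IsInvariant κ ν) (huniv : μ univ = ν univ) : μ = ν := by
  have sub_eq_zero_of_mem {s : Set X} (hx : x₀ ∈ s) {μ ν : Measure X}
      (h : ∫⁻ x, κ x s ∂(ν - μ) = 0) : ν - μ = 0 :=
    measure_eq_zero_of_lintegral_eq_zero hg hg0
      (nonpos_iff_eq_zero.1 ((lintegral_mono fun x => hgκ x s hx).trans h.le))
  obtain ⟨s, hs, hνμ, hμν⟩ := Measure.mutually_singular_measure_sub (μ := ν) (ν := μ)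
  by_cases hx : x₀ ∈ s
  · exact measure_eq_of_sub_eq_zero (sub_eq_zero_of_mem hx
      (lintegral_measure_sub_eq_zero (fun x => hκ x s) hνμ hμν (hμ s hs) (hν s hs))) huniv
  · exact (measure_eq_of_sub_eq_zero (sub_eq_zero_of_mem (mem_compl hx)
      (lintegral_measure_sub_eq_zero (fun x => hκ x sᶜ) hμν (by rwa [compl_compl])
        (hν _ hs.compl) (hμ _ hs.compl))) huniv.symm).symm

end Invariance

section Configurations

variable {α β : Type*} [MeasurableSpace α] [MeasurableSpace β]

theorem measurable_multiset_ofFn (n : ℕ) :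
    Measurable fun x : Fin n → α => (List.ofFn x : Multiset α) :=
  fun _ hs => MeasurableSpace.measurableSet_iInf.1 hs n

theorem measurable_of_measurable_ofFn {f : Multiset α → β}
    (hf : ∀ n, Measurable fun x : Fin n → α => f (List.ofFn x : Multiset α)) : Measurable f :=
  fun _ hs => MeasurableSpace.measurableSet_iInf.2 fun n => hf n hs

theorem measurable_multiset_map {f : α → β} (hf : Measurable f) :
    Measurable (Multiset.map f) := by
  refine measurable_of_measurable_ofFn fun n => ?_
  have hcomp : Measurable fun x : Fin n → α => f ∘ x :=
    measurable_pi_lambda _ fun i => hf.comp (measurable_pi_apply i)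
  simpa [Function.comp_def, List.map_ofFn] using (measurable_multiset_ofFn n).comp hcomp

theorem measurable_multiset_card : Measurable (Multiset.card : Multiset α → ℕ) :=
  measurable_of_measurable_ofFn fun n => by simp

/-- The action on configurations of a measurable equivalence of the points. -/
def configEquiv (e : α ≃ᵐ β) : Multiset α ≃ᵐ Multiset β where
  toFun := Multiset.map e
  invFun := Multiset.map e.symm
  left_inv Φ := by simp
  right_inv Φ := by simp
  measurable_toFun := measurable_multiset_map e.measurable
  measurable_invFun := measurable_multiset_map e.symm.measurable

@[simp]
theorem configEquiv_apply (e : α ≃ᵐ β) (Φ : Multiset α) : configEquiv e Φ = Φ.map e := rfl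

end Configurations

section BandSymmetry

variable {K : ℕ}

/-- The permutation of the classes induced by a permutation of the bands. -/
def permClass (σ : Equiv.Perm (Fin K)) : Equiv.Perm (BandClass K) :=
  σ.finsetCongr.subtypeEquiv fun C => by simp

@[simp]
theorem coe_permClass (σ : Equiv.Perm (Fin K)) (C : BandClass K) :
    (permClass σ C).1 = C.1.map σ.toEmbedding := rfl

theorem exists_permClass_eq {C D : BandClass K} (h : C.1.card = D.1.card) :
    ∃ σ, permClass σ C = D :=
  (Equiv.Perm.exists_map_finset_eq C.1 D.1 h).imp fun _ => Subtype.ext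

/-- The action on users of a permutation of the bands, which changes only the class. -/
def permUser (a : ℝ) (σ : Equiv.Perm (Fin K)) : User a K ≃ᵐ User a K :=
  .prodCongr (.refl _) (.prodCongr (.refl _)
    ⟨permClass σ, measurable_from_top, measurable_from_top⟩)

variable {a : ℝ} (σ : Equiv.Perm (Fin K))

@[simp]
theorem receiver_permUser (u : User a K) : (permUser a σ u).receiver = u.receiver := rfl

@[simp]
theorem transmitter_permUser (u : User a K) : (permUser a σ u).transmitter = u.transmitter := rfl

@[simp]
theorem bands_permUser (u : User a K) : (permUser a σ u).bands = permClass σ u.bands := rfl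

theorem userDensity_map_permUser [Fact (0 < a)] (π : Measure (Config a K)) (C : BandClass K) :
    userDensity (π.map (configEquiv (permUser a σ))) (permClass σ C) = userDensity π C := by
  simp only [userDensity, lintegral_map_equiv, configEquiv_apply, Multiset.filter_map,
    Multiset.card_map, Function.comp_def, bands_permUser, EmbeddingLike.apply_eq_iff_eq]

namespace Network

variable (N : Network K)

/-- A permutation of the bands that preserves the arrival probability and the mean file size of
every class. -/
structure IsBandSymmetry (σ : Equiv.Perm (Fin K)) : Prop where
  p_permClass : ∀ C, N.p (permClass σ C) = N.p C
  L_permClass : ∀ C, N.L (permClass σ C) = N.L C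

theorem interference_permUser (u : User a K) (Ψ : Config a K) :
    N.interference (permUser a σ u) (Ψ.map (permUser a σ)) = N.interference u Ψ := by
  simp [interference, Multiset.map_map, Function.comp_def, ← Finset.map_inter]

theorem rate_permUser (u : User a K) (Φ : Config a K) :
    N.rate (permUser a σ u) (Φ.map (permUser a σ)) = N.rate u Φ := by
  classical
  simp only [rate, ← Multiset.map_erase _ (permUser a σ).injective, interference_permUser,
    bands_permUser, coe_permClass, Finset.card_map]

variable {N σ}

theorem IsSymmetric.isBandSymmetry (hN : N.IsSymmetric) (σ : Equiv.Perm (Fin K)) :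
    N.IsBandSymmetry σ where
  p_permClass C := (hN _ C (by simp)).1
  L_permClass C := (hN _ C (by simp)).2

theorem deathRate_permUser (hσ : N.IsBandSymmetry σ) (u : User a K) (Φ : Config a K) :
    N.deathRate (permUser a σ u) (Φ.map (permUser a σ)) = N.deathRate u Φ := by
  simp only [deathRate, rate_permUser, bands_permUser, hσ.L_permClass]

variable [Fact (0 < a)]

theorem map_permUser_arrivals (hσ : N.IsBandSymmetry σ) :
    (N.arrivals (a := a)).map (permUser a σ) = N.arrivals := by
  have hm := (permUser a σ).measurable
  rw [arrivals, ← Measure.mapₗ_apply_of_measurable hm, map_sum]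
  refine Fintype.sum_equiv (permClass σ) _ _ fun C => ?_
  rw [_root_.map_smul, Measure.mapₗ_apply_of_measurable hm,
    Measure.map_map hm (N.measurable_dipole C), hσ.p_permClass]
  rfl

theorem jumpRate_map_permUser (hσ : N.IsBandSymmetry σ) (Φ : Config a K) :
    N.jumpRate (Φ.map (permUser a σ)) = (N.jumpRate Φ).map (configEquiv (permUser a σ)) := by
  classical
  have hm := (permUser a σ).measurable
  have hM := (configEquiv (permUser a σ)).measurable
  rw [jumpRate, jumpRate, Measure.map_add _ _ hM, map_multiset_sum_measure _ hM,
    Multiset.map_map, Multiset.map_map, Measure.map_map hM (measurable_cons Φ)]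
  congr 1
  · rw [← map_permUser_arrivals hσ, Measure.map_map (measurable_cons _) hm,
      map_permUser_arrivals hσ]
    congr 1
    funext u
    simp
  · congr 1
    refine Multiset.map_congr rfl fun u _ => ?_
    simp only [Function.comp_apply, deathRate_permUser hσ, Measure.map_smul,
      Measure.map_dirac' hM, configEquiv_apply, Multiset.map_erase _ (permUser a σ).injective]

theorem transitionAux_map_permUser (hσ : N.IsBandSymmetry σ) (n : ℕ) (t : ℝ) (Φ : Config a K)
    (A : Set (Config a K)) :
    N.transitionAux n t (Φ.map (permUser a σ)) A =
      N.transitionAux n t Φ (configEquiv (permUser a σ) ⁻¹' A) := by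
  induction n generalizing t Φ with
  | zero => rfl
  | succ n ih =>
    have hM := (configEquiv (permUser a σ)).measurable
    simp only [transitionAux, jumpRate_map_permUser hσ, lintegral_map_equiv, configEquiv_apply,
      ih, map_measureReal_apply hM MeasurableSet.univ, preimage_univ]
    rfl

theorem transition_map_permUser (hσ : N.IsBandSymmetry σ) (t : ℝ) (Φ : Config a K)
    (A : Set (Config a K)) :
    N.transition t (Φ.map (permUser a σ)) A =
      N.transition t Φ (configEquiv (permUser a σ) ⁻¹' A) :=
  iSup_congr fun n => transitionAux_map_permUser hσ n t Φ A

end Network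

end BandSymmetry

namespace Network

section Rates

variable {a : ℝ} {K : ℕ} (N : Network K)

theorem pathLoss_le_one {d : ℝ} (hd : 0 ≤ d) : N.pathLoss d ≤ 1 :=
  N.pathLoss_zero ▸ N.pathLoss_antitone (mem_Ici.2 le_rfl) (mem_Ici.2 hd) hd

theorem interference_nonneg (u : User a K) (Ψ : Config a K) : 0 ≤ N.interference u Ψ := by
  refine Multiset.sum_nonneg fun x hx => ?_
  obtain ⟨z, -, rfl⟩ := Multiset.mem_map.1 hx
  exact mul_nonneg (Nat.cast_nonneg _) (N.pathLoss_nonneg _ (Real.sqrt_nonneg _))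

theorem interference_le (u : User a K) (Ψ : Config a K) :
    N.interference u Ψ ≤ Multiset.card Ψ * K := by
  rw [interference, ← nsmul_eq_mul, ← Multiset.card_map]
  refine Multiset.sum_le_card_nsmul _ _ fun x hx => ?_
  obtain ⟨z, -, rfl⟩ := Multiset.mem_map.1 hx
  have hcard : ((u.bands.1 ∩ z.bands.1).card : ℝ) ≤ K := by
    exact_mod_cast card_finset_fin_le _
  exact (mul_le_of_le_one_right (Nat.cast_nonneg _)
    (N.pathLoss_le_one (Real.sqrt_nonneg _))).trans hcard

theorem deathRate_le (u : User a K) (Φ : Config a K) :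
    N.deathRate u Φ ≤ ∑ C : BandClass K, (C.1.card : ℝ) * N.pathLoss N.r / N.noise / N.L C := by
  have hloss := N.pathLoss_nonneg _ N.r_nonneg
  have hnoise := N.noise_pos
  have hL (C) := (N.L_pos C).le
  calc N.deathRate u Φ
      ≤ (u.bands.1.card : ℝ) * N.pathLoss N.r / N.noise / N.L u.bands := by
        unfold deathRate rate
        gcongr
        · exact hL _
        · exact le_add_of_nonneg_right (N.interference_nonneg _ _)
    _ ≤ _ := Finset.single_le_sum
        (f := fun C : BandClass K => (C.1.card : ℝ) * N.pathLoss N.r / N.noise / N.L C)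
        (fun C _ => div_nonneg (by positivity) (hL C)) (Finset.mem_univ u.bands)

theorem sum_L_pos : 0 < ∑ C, N.L C :=
  Finset.sum_pos (fun C _ => N.L_pos C)
    (Finset.nonempty_of_sum_ne_zero (N.p_sum.trans_ne one_ne_zero))

theorem le_deathRate (u : User a K) (Φ : Config a K) :
    N.pathLoss N.r / (N.noise + Multiset.card Φ * K) / ∑ C, N.L C ≤ N.deathRate u Φ := by
  classical
  have hloss := N.pathLoss_nonneg _ N.r_nonneg
  have hnoise := N.noise_pos
  have hL := N.L_pos u.bands
  have hsum : N.L u.bands ≤ ∑ C, N.L C :=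
    Finset.single_le_sum (fun C _ => (N.L_pos C).le) (Finset.mem_univ u.bands)
  have hcard : (1 : ℝ) ≤ u.bands.1.card := by exact_mod_cast u.bands.2.card_pos
  have hpos := N.interference_nonneg u (Φ.erase u)
  have hle : N.interference u (Φ.erase u) ≤ Multiset.card Φ * K :=
    (N.interference_le u _).trans (by gcongr; exact Multiset.erase_le u Φ)
  calc N.pathLoss N.r / (N.noise + Multiset.card Φ * K) / ∑ C, N.L C
      ≤ (u.bands.1.card * N.pathLoss N.r) / (N.noise + N.interference u (Φ.erase u)) /
        N.L u.bands := by
        gcongr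
        exact le_mul_of_one_le_left hloss hcard
    _ = N.deathRate u Φ := by
        unfold deathRate rate
        congr!

variable [Fact (0 < a)]

theorem arrivals_univ :
    N.arrivals (univ : Set (User a K)) =
      ENNReal.ofReal N.lam * volume (univ : Set (Torus a)) := by
  have h2π : ENNReal.ofReal (2 * Real.pi) ≠ 0 := by simp [Real.pi_pos]
  have hmass (C : BandClass K) : (((volume : Measure (Torus a)).prod
      ((ENNReal.ofReal (2 * Real.pi))⁻¹ • volume.restrict (Ioc 0 (2 * Real.pi)))).map
        (fun q : Torus a × ℝ => N.dipole C q.1 q.2)) univ = volume (univ : Set (Torus a)) := by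
    rw [Measure.map_apply (N.measurable_dipole C) MeasurableSet.univ, preimage_univ,
      ← univ_prod_univ, Measure.prod_prod, Measure.smul_apply, Measure.restrict_apply_univ,
      Real.volume_Ioc, sub_zero, smul_eq_mul, ENNReal.inv_mul_cancel h2π ENNReal.ofReal_ne_top,
      mul_one]
  simp only [arrivals, Measure.coe_finsetSum, Finset.sum_apply, Measure.smul_apply, smul_eq_mul,
    hmass]
  rw [← Finset.sum_mul, ← ENNReal.ofReal_sum_of_nonneg fun C _ =>
    mul_nonneg N.lam_pos.le (N.p_nonneg C), ← Finset.mul_sum, N.p_sum, mul_one]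

instance : IsFiniteMeasure (N.arrivals (a := a)) :=
  ⟨by rw [arrivals_univ]; exact ENNReal.mul_lt_top ENNReal.ofReal_lt_top (measure_lt_top _ _)⟩

theorem arrivals_real_univ_pos : 0 < (N.arrivals (a := a)).real univ := by
  have hvol : volume (univ : Set (Torus a)) ≠ 0 := Measure.measure_univ_ne_zero.2 (NeZero.ne _)
  refine ENNReal.toReal_pos ?_ (measure_ne_top _ _)
  simpa [arrivals_univ, N.lam_pos] using hvol

open Classical in
theorem jumpRate_apply (Φ : Config a K) (A : Set (Config a K)) :
    N.jumpRate Φ A = (N.arrivals (a := a)).map (fun u => u ::ₘ Φ) A +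
      (Φ.map fun u => ENNReal.ofReal (N.deathRate u Φ) *
        (Measure.dirac (Φ.erase u) : Measure (Config a K)) A).sum := by
  simp only [jumpRate, Measure.add_apply, multiset_sum_measure_apply, Multiset.map_map,
    Function.comp_def, Measure.smul_apply, smul_eq_mul]

theorem jumpRate_univ_le (Φ : Config a K) :
    N.jumpRate Φ univ ≤ N.arrivals (univ : Set (User a K)) + Multiset.card Φ *
      ENNReal.ofReal (∑ C : BandClass K, (C.1.card : ℝ) * N.pathLoss N.r / N.noise / N.L C) := by
  classical
  rw [jumpRate_apply, Measure.map_apply (measurable_cons Φ) MeasurableSet.univ, preimage_univ]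
  gcongr
  rw [← nsmul_eq_mul, ← Multiset.card_map]
  refine Multiset.sum_le_card_nsmul _ _ fun x hx => ?_
  obtain ⟨u, -, rfl⟩ := Multiset.mem_map.1 hx
  rw [measure_univ, mul_one]
  exact ENNReal.ofReal_le_ofReal (N.deathRate_le u Φ)

instance (Φ : Config a K) : IsFiniteMeasure (N.jumpRate Φ) :=
  ⟨(N.jumpRate_univ_le Φ).trans_lt (ENNReal.add_lt_top.2 ⟨measure_lt_top _ _,
    ENNReal.mul_lt_top (ENNReal.natCast_lt_top _) ENNReal.ofReal_lt_top⟩)⟩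

theorem exists_jumpRate_real_univ_le (a : ℝ) [Fact (0 < a)] (n : ℕ) :
    ∃ Q : ℝ, ∀ Φ : Config a K, Multiset.card Φ = n → (N.jumpRate Φ).real univ ≤ Q := by
  refine ⟨(N.arrivals (univ : Set (User a K)) + n * ENNReal.ofReal
    (∑ C : BandClass K, (C.1.card : ℝ) * N.pathLoss N.r / N.noise / N.L C)).toReal, ?_⟩
  rintro Φ rfl
  exact ENNReal.toReal_mono (by finiteness) (N.jumpRate_univ_le Φ)

open Classical in
theorem ofReal_deathRate_le_jumpRate {u : User a K} {Φ : Config a K} (hu : u ∈ Φ)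
    {A : Set (Config a K)} (hA : Φ.erase u ∈ A) :
    ENNReal.ofReal (N.deathRate u Φ) ≤ N.jumpRate Φ A := by
  rw [jumpRate_apply]
  refine le_add_left ?_
  simpa only [Measure.dirac_apply_of_mem hA, mul_one] using
    Multiset.single_le_sum (fun _ _ => zero_le) _ (Multiset.mem_map_of_mem
      (fun v => ENNReal.ofReal (N.deathRate v Φ) *
        (Measure.dirac (Φ.erase v) : Measure (Config a K)) A) hu)

theorem exists_le_jumpRate_card_eq (a : ℝ) [Fact (0 < a)] (h : 0 < N.pathLoss N.r) (n : ℕ) :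
    ∃ c : ℝ≥0∞, c ≠ 0 ∧ ∀ Φ : Config a K, Multiset.card Φ = n + 1 →
      c ≤ N.jumpRate Φ {Ψ | Multiset.card Ψ = n} := by
  classical
  have hnoise := N.noise_pos
  have hL := N.sum_L_pos
  refine ⟨ENNReal.ofReal (N.pathLoss N.r / (N.noise + (n + 1 : ℕ) * K) / ∑ C, N.L C),
    (ENNReal.ofReal_pos.2 (by positivity)).ne', fun Φ hΦ => ?_⟩
  obtain ⟨u, hu⟩ := Multiset.card_pos_iff_exists_mem.1 (by lia : 0 < Multiset.card Φ)
  calc _ ≤ ENNReal.ofReal (N.deathRate u Φ) :=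
        ENNReal.ofReal_le_ofReal (hΦ ▸ N.le_deathRate u Φ)
    _ ≤ _ := N.ofReal_deathRate_le_jumpRate hu (by simp [Multiset.card_erase_of_mem hu, hΦ])

end Rates

section Emptying

variable {a : ℝ} {K : ℕ} [Fact (0 < a)] (N : Network K)

theorem transitionAux_le_one (n : ℕ) {t : ℝ} (ht : 0 ≤ t) (Φ : Config a K)
    (A : Set (Config a K)) : N.transitionAux n t Φ A ≤ 1 := by
  induction n generalizing t Φ with
  | zero => exact zero_le
  | succ n ih =>
    set q := (N.jumpRate Φ).real univ with hq
    have hq0 : 0 ≤ q := measureReal_nonneg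
    have hqt : Real.exp (-(q * t)) ≤ 1 := Real.exp_le_one_iff.2 (by nlinarith)
    have hind : A.indicator (1 : Config a K → ℝ≥0∞) Φ ≤ 1 :=
      indicator_le_self' (fun _ _ => zero_le) Φ
    have hjump (s : ℝ) (hs : s ∈ Ioc 0 t) :
        ∫⁻ Ψ, N.transitionAux n (t - s) Ψ A ∂(N.jumpRate Φ) ≤ ENNReal.ofReal q := by
      refine (lintegral_mono fun Ψ => ih (sub_nonneg.2 hs.2) Ψ).trans ?_
      rw [lintegral_one, hq, ofReal_measureReal]
    calc N.transitionAux (n + 1) t Φ A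
        ≤ ENNReal.ofReal (Real.exp (-(q * t))) * 1 +
          ∫⁻ s in Ioc 0 t, ENNReal.ofReal (Real.exp (-(q * s))) * ENNReal.ofReal q := by
          rw [transitionAux]
          exact add_le_add (mul_le_mul_right hind _)
            (setLIntegral_mono' measurableSet_Ioc fun s hs => mul_le_mul_right (hjump s hs) _)
      _ = 1 := by
          rw [lintegral_exp_neg_mul hq0 ht, mul_one, ← ENNReal.ofReal_add (Real.exp_pos _).le
            (sub_nonneg.2 hqt), add_sub_cancel, ENNReal.ofReal_one]

theorem transition_le_one {t : ℝ} (ht : 0 ≤ t) (Φ : Config a K) (A : Set (Config a K)) :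
    N.transition t Φ A ≤ 1 :=
  iSup_le fun n => N.transitionAux_le_one n ht Φ A

theorem exp_neg_le_transitionAux_succ (n : ℕ) (t : ℝ) {Φ : Config a K} {A : Set (Config a K)}
    (hΦ : Φ ∈ A) :
    ENNReal.ofReal (Real.exp (-((N.jumpRate Φ).real univ * t))) ≤
      N.transitionAux (n + 1) t Φ A := by
  rw [transitionAux, indicator_of_mem hΦ, Pi.one_apply, mul_one]
  exact le_self_add

theorem mul_jumpRate_le_transitionAux_succ (n : ℕ) {s₀ t : ℝ} (hs₀ : s₀ ≤ t) (Φ : Config a K)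
    {A B : Set (Config a K)} (hB : MeasurableSet B) {c : ℝ≥0∞}
    (hc : ∀ s ∈ Ioc 0 s₀, ∀ Ψ ∈ B, c ≤ N.transitionAux n (t - s) Ψ A) :
    ENNReal.ofReal (Real.exp (-((N.jumpRate Φ).real univ * t))) * (c * N.jumpRate Φ B) *
      ENNReal.ofReal s₀ ≤ N.transitionAux (n + 1) t Φ A := by
  set q := (N.jumpRate Φ).real univ
  have : 0 ≤ q := measureReal_nonneg
  have hjump (s : ℝ) (hs : s ∈ Ioc 0 s₀) :
      c * N.jumpRate Φ B ≤ ∫⁻ Ψ, N.transitionAux n (t - s) Ψ A ∂(N.jumpRate Φ) := by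
    rw [← lintegral_indicator_const hB]
    exact lintegral_mono (indicator_le' (hc s hs) fun _ _ => zero_le)
  calc _ = ∫⁻ _ in Ioc 0 s₀, ENNReal.ofReal (Real.exp (-(q * t))) * (c * N.jumpRate Φ B) := by
        rw [setLIntegral_const, Real.volume_Ioc, sub_zero]
    _ ≤ ∫⁻ s in Ioc 0 s₀, ENNReal.ofReal (Real.exp (-(q * s))) *
        ∫⁻ Ψ, N.transitionAux n (t - s) Ψ A ∂(N.jumpRate Φ) := by
        refine setLIntegral_mono' measurableSet_Ioc fun s hs => ?_
        gcongr
        · exact hs.2.trans hs₀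
        · exact hjump s hs
    _ ≤ ∫⁻ s in Ioc 0 t, ENNReal.ofReal (Real.exp (-(q * s))) *
        ∫⁻ Ψ, N.transitionAux n (t - s) Ψ A ∂(N.jumpRate Φ) :=
        lintegral_mono_set (Ioc_subset_Ioc_right hs₀)
    _ ≤ _ := by
        rw [transitionAux]
        exact le_add_self

theorem exists_le_exp_neg_jumpRate (a : ℝ) [Fact (0 < a)] (n : ℕ) (T : ℝ) :
    ∃ b : ℝ≥0∞, b ≠ 0 ∧ ∀ t ∈ Icc 0 T, ∀ Φ : Config a K, Multiset.card Φ = n →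
      b ≤ ENNReal.ofReal (Real.exp (-((N.jumpRate Φ).real univ * t))) := by
  obtain ⟨Q, hQ⟩ := N.exists_jumpRate_real_univ_le a n
  refine ⟨ENNReal.ofReal (Real.exp (-(Q * T))), by simp [Real.exp_pos], fun t ht Φ hΦ => ?_⟩
  have hqt : (N.jumpRate Φ).real univ * t ≤ Q * T :=
    mul_le_mul (hQ Φ hΦ) ht.2 ht.1 (measureReal_nonneg.trans (hQ Φ hΦ))
  gcongr

theorem exists_le_transitionAux_of_zero_mem (a : ℝ) [Fact (0 < a)] (h : 0 < N.pathLoss N.r)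
    (n : ℕ) {t₁ : ℝ} (ht₁ : 0 < t₁) (t₂ : ℝ) :
    ∃ c : ℝ≥0∞, c ≠ 0 ∧ ∀ t ∈ Icc t₁ t₂, ∀ Φ : Config a K, Multiset.card Φ = n →
      ∀ A : Set (Config a K), 0 ∈ A → c ≤ N.transitionAux (n + 1) t Φ A := by
  induction n generalizing t₁ with
  | zero =>
    obtain ⟨b, hb, hexp⟩ := N.exists_le_exp_neg_jumpRate a 0 t₂
    refine ⟨b, hb, fun t ht Φ hΦ A hA => ?_⟩
    exact (hexp t ⟨ht₁.le.trans ht.1, ht.2⟩ Φ hΦ).trans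
      (N.exp_neg_le_transitionAux_succ 0 t (Multiset.card_eq_zero.1 hΦ ▸ hA))
  | succ n ih =>
    obtain ⟨b, hb, hexp⟩ := N.exists_le_exp_neg_jumpRate a (n + 1) t₂
    obtain ⟨d, hd, hjump⟩ := N.exists_le_jumpRate_card_eq a h n
    obtain ⟨c, hc, hempty⟩ := ih (half_pos ht₁)
    refine ⟨b * (c * d) * ENNReal.ofReal (t₁ / 2), by simp [hb, hc, hd, ht₁],
      fun t ht Φ hΦ A hA => ?_⟩
    have ht₀ : t₁ / 2 ≤ t := (half_le_self ht₁.le).trans ht.1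
    refine le_trans ?_ (N.mul_jumpRate_le_transitionAux_succ (n + 1) ht₀ Φ
      (measurable_multiset_card (measurableSet_singleton n)) fun s hs Ψ hΨ =>
        hempty (t - s) ⟨by linarith [hs.2, ht.1], by linarith [hs.1, ht.2]⟩ Ψ hΨ A hA)
    gcongr
    · exact hexp t ⟨ht₁.le.trans ht.1, ht.2⟩ Φ hΦ
    · exact hjump Φ hΦ

end Emptying

section NoService

variable {a : ℝ} {K : ℕ} [Fact (0 < a)] {N : Network K} (h : N.pathLoss N.r = 0)
include h

theorem jumpRate_of_pathLoss_eq_zero (Φ : Config a K) :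
    N.jumpRate Φ = (N.arrivals (a := a)).map (fun u => u ::ₘ Φ) := by
  simp [jumpRate, deathRate, rate, h]

theorem lintegral_jumpRate_eq_zero {Φ : Config a K} {f : Config a K → ℝ≥0∞}
    (hf : ∀ u, f (u ::ₘ Φ) = 0) : ∫⁻ Ψ, f Ψ ∂(N.jumpRate Φ) = 0 := by
  rw [jumpRate_of_pathLoss_eq_zero h]
  simpa [hf] using lintegral_map_le (μ := N.arrivals) f (fun u => u ::ₘ Φ)

theorem transitionAux_card_lt_eq_zero {m : ℕ} (n : ℕ) (t : ℝ) (Φ : Config a K)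
    (hΦ : m ≤ Multiset.card Φ) : N.transitionAux n t Φ {Ψ | Multiset.card Ψ < m} = 0 := by
  induction n generalizing t Φ with
  | zero => rfl
  | succ n ih =>
    have hjump (s : ℝ) : ∫⁻ Ψ, N.transitionAux n (t - s) Ψ {Ψ | Multiset.card Ψ < m}
        ∂(N.jumpRate Φ) = 0 :=
      lintegral_jumpRate_eq_zero h fun u => ih _ _ (hΦ.trans (by simp))
    simp [transitionAux, hjump, hΦ]

theorem transition_card_lt_succ_le {m : ℕ} (t : ℝ) (Φ : Config a K)
    (hΦ : m ≤ Multiset.card Φ) :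
    N.transition t Φ {Ψ | Multiset.card Ψ < m + 1} ≤ {Ψ | Multiset.card Ψ < m + 1}.indicator
      (fun _ => ENNReal.ofReal (Real.exp (-((N.arrivals (a := a)).real univ * t)))) Φ := by
  have hq : (N.jumpRate Φ).real univ = (N.arrivals (a := a)).real univ := by
    rw [jumpRate_of_pathLoss_eq_zero h, map_measureReal_apply (measurable_cons Φ)
      MeasurableSet.univ, preimage_univ]
  refine iSup_le fun n => ?_
  cases n with
  | zero => exact zero_le
  | succ n =>
    have hjump (s : ℝ) : ∫⁻ Ψ, N.transitionAux n (t - s) Ψ {Ψ | Multiset.card Ψ < m + 1}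
        ∂(N.jumpRate Φ) = 0 :=
      lintegral_jumpRate_eq_zero h fun u =>
        transitionAux_card_lt_eq_zero h n _ _ (by simpa using hΦ)
    rw [transitionAux, hq]
    simp only [hjump, mul_zero, lintegral_zero, add_zero]
    simp [indicator]

variable {t : ℝ} (ht : 0 < t) {π : Measure (Config a K)} [IsFiniteMeasure π]
  (hπ : IsInvariant (N.transition t) π)
include ht hπ

theorem measure_card_lt_eq_zero (m : ℕ) : π {Φ | Multiset.card Φ < m} = 0 := by
  induction m with
  | zero => simp
  | succ m ih =>
    have hmeas : MeasurableSet {Φ : Config a K | Multiset.card Φ < m + 1} :=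
      measurable_multiset_card measurableSet_Iio
    have hcard : ∀ᵐ Φ ∂π, m ≤ Multiset.card Φ := by simpa [ae_iff] using ih
    have hlt : ENNReal.ofReal (Real.exp (-((N.arrivals (a := a)).real univ * t))) < 1 := by
      simpa using mul_pos N.arrivals_real_univ_pos ht
    by_contra hne
    refine (ENNReal.mul_lt_mul_left hne (measure_ne_top _ _) hlt).not_ge ?_
    rw [one_mul, ← lintegral_indicator_const hmeas, ← hπ _ hmeas]
    exact lintegral_mono_ae (hcard.mono fun Φ hΦ => transition_card_lt_succ_le h t Φ hΦ)

theorem eq_zero_of_isInvariant_transition : π = 0 := by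
  have hunion : (univ : Set (Config a K)) = ⋃ m : ℕ, {Φ | Multiset.card Φ < m} :=
    (iUnion_eq_univ_iff.2 fun Φ => ⟨_, Nat.lt_succ_self (Multiset.card Φ)⟩).symm
  rw [← Measure.measure_univ_eq_zero, hunion]
  exact measure_iUnion_null (measure_card_lt_eq_zero h ht hπ)

end NoService

theorem eq_of_isInvariant_transition {a : ℝ} {K : ℕ} [Fact (0 < a)] {N : Network K} {t : ℝ}
    (ht : 0 < t) {μ ν : Measure (Config a K)} [IsFiniteMeasure μ] [IsFiniteMeasure ν]
    (hμ : IsInvariant (N.transition t) μ) (hν : IsInvariant (N.transition t) ν)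
    (huniv : μ univ = ν univ) : μ = ν := by
  rcases (N.pathLoss_nonneg _ N.r_nonneg).eq_or_lt with h | h
  · rw [eq_zero_of_isInvariant_transition h.symm ht hμ,
      eq_zero_of_isInvariant_transition h.symm ht hν]
  choose c hc hempty using fun n => N.exists_le_transitionAux_of_zero_mem a h n ht t
  refine hμ.eq_of_minorization (N.transition_le_one ht.le) 0 (g := fun Φ => c (Multiset.card Φ))
    (measurable_from_top.comp measurable_multiset_card) (fun Φ => hc _) (fun Φ A hA => ?_)
    hν huniv
  exact (hempty _ t ⟨le_rfl, le_rfl⟩ Φ rfl A hA).trans (le_iSup_iff.2 fun _ hb => hb _)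

end Network

end WirelessSBD

theorem mainTheorem11_general {K : ℕ} {a : ℝ} [Fact (0 < a)] {N : WirelessSBD.Network K}
    {σ : Equiv.Perm (Fin K)} (hσ : N.IsBandSymmetry σ) {t : ℝ} (ht : 0 < t)
    {π : MeasureTheory.Measure (WirelessSBD.Config a K)} [MeasureTheory.IsFiniteMeasure π]
    (hπ : WirelessSBD.IsInvariant (N.transition t) π) (C : WirelessSBD.BandClass K) :
    WirelessSBD.userDensity π (WirelessSBD.permClass σ C) = WirelessSBD.userDensity π C := by
  set e := WirelessSBD.configEquiv (WirelessSBD.permUser a σ)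
  have hmap : WirelessSBD.IsInvariant (N.transition t) (π.map e) :=
    hπ.map_equiv (WirelessSBD.Network.transition_map_permUser hσ t)
  have huniv : π.map e univ = π univ := by rw [e.map_apply, preimage_univ]
  have hinv : π.map e = π :=
    WirelessSBD.Network.eq_of_isInvariant_transition ht hmap hπ huniv
  calc WirelessSBD.userDensity π (WirelessSBD.permClass σ C)
      = WirelessSBD.userDensity (π.map e) (WirelessSBD.permClass σ C) := by rw [hinv]
    _ = WirelessSBD.userDensity π C := WirelessSBD.userDensity_map_permUser σ π C

theorem mainTheorem11 {K : ℕ} {a : ℝ} [Fact (0 < a)] (N : WirelessSBD.Network K)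
    (hN : N.IsSymmetric) (π : MeasureTheory.Measure (WirelessSBD.Config a K))
    (hπ : N.IsStationary π) (C D : WirelessSBD.BandClass K) (hCD : C.1.card = D.1.card) :
    WirelessSBD.userDensity π C = WirelessSBD.userDensity π D := by
  have := hπ.1
  obtain ⟨σ, rfl⟩ := WirelessSBD.exists_permClass_eq hCD
  exact (mainTheorem11_general (hN.isBandSymmetry σ) one_pos (hπ.2 1 zero_le_one) C).symm
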